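/- Let $X$ be a complex Banach space, $T\in L(X)$ a bounded linear operator on $X$, and let $\sigma_*\in\{\sigma,\sigma_b,\sigma_d\}$, where $\sigma(T)$ is the spectrum, $\sigma_b(T)=\{\lambda\in\mathbb{C}: T-\lambda I \text{ is not Browder}\}$ and $\sigma_d(T)=\{\lambda\in\mathbb{C}: T-\lambda I\text{ is not Drazin invertible}\}$. (An operator is Drazin invertible if it has finite ascent and finite descent, and Browder if it is moreover Fredholm.) For $A\subset\mathbb{C}$ let $\operatorname{acc}A$ be the set of accumulation points of $A$ and define, by transfinite recursion, $\operatorname{acc}^{0}A=A$, $\operatorname{acc}^{\gamma+1}A=\operatorname{acc}(\operatorname{acc}^{\gamma}A)$, and $\operatorname{acc}^{\lambda}A=\bigcap_{\beta<\lambda}\operatorname{acc}^{\beta}A$ for limit ordinals $\lambda$. For a $T$-invariant subspace $M$ (that is, $T(M)\subset M$), $T_M:M\to M$ denotes the restriction of $T$. Let $\alpha\ge 1$ be a successor ordinal with predecessor $\alpha-1$. The operator $T$ is called $g^{\alpha}_{\sigma_*}$-invertible if there are closed $T$-invariant subspaces $M,N$ of $X$ such that $X=M\oplus N$, $T_M$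 is invertible in $L(M)$, and $\operatorname{acc}^{\alpha-1}\sigma_*(T_N)\subset\{0\}$. Theorem. $T$ is $g^{\alpha}_{\sigma_*}$-invertible if and only if there are $T$-invariant linear subspaces $M,N$ of $X$ such that $N$ is closed, $X=M\oplus N$ (algebraic direct sum; $M$ is not assumed closed), $T_M$ is invertible, i.e. $T_M:M\to M$ is bijective, and $\operatorname{acc}^{\alpha-1}\sigma_*(T_N)\subset\{0\}$. -/

import Mathlib

open Filter Topology

universe u v

/-- The `α`-th Cantor-Bendixson derivative `acc^α A` of a set `A`: start from `A`, take the set of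
accumulation points at successor steps and intersections at limit steps. -/
noncomputable def accIter {Y : Type u} [TopologicalSpace Y] (A : Set Y) (α : Ordinal.{v}) : Set Y :=
  Ordinal.limitRecOn α A (fun _ S => derivedSet S) (fun β _ S => ⋂ γ, ⋂ h : γ < β, S γ h)

theorem accIter_zero {Y : Type u} [TopologicalSpace Y] (A : Set Y) :
    accIter A (0 : Ordinal.{v}) = A :=
  Ordinal.limitRecOn_zero _ _ _

theorem accIter_add_one {Y : Type u} [TopologicalSpace Y] (A : Set Y) (α : Ordinal.{v}) :
    accIter A (α + 1) = derivedSet (accIter A α) :=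
  Ordinal.limitRecOn_add_one _ _ _ _

theorem accIter_limit {Y : Type u} [TopologicalSpace Y] (A : Set Y) (α : Ordinal.{v})
    (hα : Order.IsSuccLimit α) : accIter A α = ⋂ γ, ⋂ _ : γ < α, accIter A γ :=
  Ordinal.limitRecOn_limit _ _ _ _ hα

section Operators

variable {X : Type u} [NormedAddCommGroup X] [NormedSpace ℂ X]

/-- Finite ascent: `N(T^p) = N(T^(p+1))` for some `p`. -/
def HasFiniteAscent (T : X →L[ℂ] X) : Prop :=
  ∃ p : ℕ, (T ^ p).ker = (T ^ (p + 1)).ker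

/-- Finite descent: `R(T^q) = R(T^(q+1))` for some `q`. -/
def HasFiniteDescent (T : X →L[ℂ] X) : Prop :=
  ∃ q : ℕ, (T ^ q).range = (T ^ (q + 1)).range

/-- Drazin invertible operators: finite ascent and finite descent. -/
def IsDrazinInvertible (T : X →L[ℂ] X) : Prop :=
  HasFiniteAscent T ∧ HasFiniteDescent T

/-- Browder operators: Fredholm operators of finite ascent and finite descent. -/
def IsBrowder (T : X →L[ℂ] X) : Prop :=
  T.IsFredholm ∧ HasFiniteAscent T ∧ HasFiniteDescent T

/-- The Browder spectrum. -/
def browderSpectrum (T : X →L[ℂ] X) : Set ℂ :=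
  {z | ¬ IsBrowder (T - z • ContinuousLinearMap.id ℂ X)}

/-- The Drazin spectrum. -/
def drazinSpectrum (T : X →L[ℂ] X) : Set ℂ :=
  {z | ¬ IsDrazinInvertible (T - z • ContinuousLinearMap.id ℂ X)}

/-- The three possible choices for `σ_*`. -/
inductive SpectrumKind
  | usual
  | browder
  | drazin

/-- The spectrum `σ_*(T)`, where `σ_*` is one of `σ`, `σ_b`, `σ_d`. -/
def sigmaStar (k : SpectrumKind) (T : X →L[ℂ] X) : Set ℂ :=
  match k with
  | .usual => spectrum ℂ T
  | .browder => browderSpectrum T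
  | .drazin => drazinSpectrum T

/-- A subspace `M` is `T`-invariant if `T(M) ⊆ M`. -/
def IsInvariantSubspace (T : X →L[ℂ] X) (M : Submodule ℂ X) : Prop :=
  ∀ x ∈ M, T x ∈ M

/-- There are closed `T`-invariant subspaces `M`, `N` with `X = M ⊕ N`, `T_M` invertible in `L(M)`
and `acc^γ σ_*(T_N) ⊆ {0}`. -/
def HasGDecomposition (k : SpectrumKind) (T : X →L[ℂ] X) (γ : Ordinal.{v}) : Prop :=
  ∃ (M N : Submodule ℂ X) (hM : IsInvariantSubspace T M) (hN : IsInvariantSubspace T N),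
    IsClosed (M : Set X) ∧ IsClosed (N : Set X) ∧ IsCompl M N ∧
      IsUnit (T.restrict hM) ∧ accIter (sigmaStar k (T.restrict hN)) γ ⊆ {0}

/-- `g^α_{σ_*}`-invertible operators. The three disjuncts are the cases `α = 0`, `α` a successor
ordinal and `α` a limit ordinal. -/
def IsGInvertible (k : SpectrumKind) (T : X →L[ℂ] X) (α : Ordinal.{v}) : Prop :=
  (α = 0 ∧ (0 : ℂ) ∉ sigmaStar k T) ∨
  (∃ γ : Ordinal.{v}, α = γ + 1 ∧ HasGDecomposition k T γ) ∨
  (Order.IsSuccLimit α ∧ ∃ γ : Ordinal.{v}, γ + 1 < α ∧ HasGDecomposition k T γ)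

end Operators

/-! Only the converse needs an argument. An algebraic complement `M` on which `T` is bijective
enters only by making the map induced by `T` on `X ⧸ N` bijective. Since `N` is closed, `X ⧸ N` is a
Banach space, so `T - z` stays bijective modulo `N` for small `z`
(`IsBijectiveModulo.exists_forall_norm_lt`). Regularity of `T_N - z` then lifts to `T - z`, so near
`0` the set `σ_*(T)` lies in `σ_*(T_N)`.

Hence a closed piece of `σ_*(T)` around `0` has `γ`-th derivative inside `{0}`. It contains no
nonempty perfect set and is therefore countable. Points of `σ(T)` outside `σ_*(T)` are isolated in
`σ(T)`, so they too are countably many. Thus some small circle around `0` misses `σ(T)`, and its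
Riesz projection splits `X` into closed invariant subspaces (`exists_riesz_decomposition`). These
replace the given pair: `T` is invertible on the kernel, and on the range `σ_*` is contained in the
piece already controlled. -/

/-! ### Cantor–Bendixson derivatives and countability -/

theorem accIter_mono {Y : Type u} [TopologicalSpace Y] {A B : Set Y} (h : A ⊆ B)
    (α : Ordinal.{v}) : accIter A α ⊆ accIter B α := by
  induction α using Ordinal.limitRecOn with
  | zero => simpa only [accIter_zero] using h
  | add_one α ih =>
    rw [accIter_add_one, accIter_add_one]
    exact derivedSet_mono _ _ ih
  | limit α hα ih =>
    rw [accIter_limit _ _ hα, accIter_limit _ _ hα]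
    exact Set.iInter₂_mono ih

theorem Preperfect.subset_accIter {Y : Type u} [TopologicalSpace Y] {D : Set Y}
    (hD : Preperfect D) (α : Ordinal.{v}) : D ⊆ accIter D α := by
  induction α using Ordinal.limitRecOn with
  | zero => rw [accIter_zero]
  | add_one α ih =>
    rw [accIter_add_one]
    exact (preperfect_iff_subset_derivedSet.1 hD).trans (derivedSet_mono _ _ ih)
  | limit α hα ih =>
    rw [accIter_limit _ _ hα]
    exact Set.subset_iInter₂ ih

theorem Preperfect.not_subset_singleton {Y : Type u} [TopologicalSpace Y] {D : Set Y}
    (hD : Preperfect D) (hne : D.Nonempty) (y : Y) : ¬ D ⊆ {y} := by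
  intro h
  obtain ⟨x, hx⟩ := hne
  obtain ⟨z, hz, hzx⟩ := accPt_iff_nhds.1 (hD x hx) Set.univ univ_mem
  exact hzx ((h hz.2).trans (h hx).symm)

/-- An uncountable closed set contains a nonempty perfect set, which survives every derivative and
cannot fit in one point. -/
theorem IsClosed.countable_of_accIter_subset_singleton {Y : Type u} [TopologicalSpace Y]
    [SecondCountableTopology Y] {C : Set Y} (hC : IsClosed C) {α : Ordinal.{v}} {y : Y}
    (h : accIter C α ⊆ {y}) : C.Countable := by
  by_contra hunc
  obtain ⟨D, hD, hne, hDC⟩ := exists_perfect_nonempty_of_isClosed_of_not_countable hC hunc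
  exact hD.acc.not_subset_singleton hne y
    ((hD.acc.subset_accIter α).trans ((accIter_mono hDC α).trans h))

theorem Set.countable_of_forall_not_accPt {Y : Type u} [TopologicalSpace Y]
    [SecondCountableTopology Y] {A : Set Y} (h : ∀ x ∈ A, ¬ AccPt x (𝓟 A)) : A.Countable := by
  have : DiscreteTopology A := discreteTopology_subtype_iff.2 fun x hx => by
    simpa [AccPt, neBot_iff] using h x hx
  exact Set.countable_coe_iff.1 (countable_of_Lindelof_of_discrete (X := A))

/-- The norms of countably many points cannot exhaust an interval. -/
theorem exists_radius_disjoint_sphere {C : Set ℂ} {ε : ℝ} (hε : 0 < ε)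
    (hC : (C ∩ Metric.closedBall 0 ε).Countable) :
    ∃ r, 0 < r ∧ r < ε ∧ ∀ z ∈ C, ‖z‖ ≠ r := by
  have h1 : ((fun z : ℂ => ‖z‖) '' (C ∩ Metric.closedBall 0 ε)).Countable := hC.image _
  have h2 : ¬ (Set.Ioo 0 ε).Countable := by
    rw [← Cardinal.le_aleph0_iff_set_countable, Cardinal.mk_Ioo_real hε, not_le]
    exact Cardinal.aleph0_lt_continuum
  obtain ⟨r, hr, hr'⟩ := Set.not_subset.1 fun hs => h2 (h1.mono hs)
  exact ⟨r, hr.1, hr.2, fun z hz hzr =>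
    hr' ⟨z, ⟨hz, by simpa [hzr] using hr.2.le⟩, hzr⟩⟩

/-! ### Riesz projection of a disc in a Banach algebra -/

section RieszProjection

open Metric Real Complex

variable {A : Type u} [NormedRing A] [NormedAlgebra ℂ A]

theorem Commute.resolvent_right {a b : A} (h : Commute b a) (z : ℂ) :
    Commute b (resolvent a z) := by
  have h' : Commute b (algebraMap ℂ A z - a) := (Algebra.commute_algebraMap_right z b).sub_right h
  by_cases hz : IsUnit (algebraMap ℂ A z - a)
  · obtain ⟨u, hu⟩ := hz
    rw [resolvent, ← hu, Ring.inverse_unit]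
    rw [← hu] at h'
    exact h'.units_inv_right
  · rw [resolvent, Ring.inverse_non_unit _ hz]
    exact Commute.zero_right b

theorem resolventSet.sub_mul_resolvent {a : A} {z : ℂ} (hz : z ∈ resolventSet ℂ a) (w : ℂ) :
    (a - algebraMap ℂ A w) * resolvent a z = (z - w) • resolvent a z - 1 := by
  have h : (algebraMap ℂ A z - a) * resolvent a z = 1 := Ring.mul_inverse_cancel _ hz
  calc (a - algebraMap ℂ A w) * resolvent a z
      = (algebraMap ℂ A (z - w) - (algebraMap ℂ A z - a)) * resolvent a z := by
        rw [map_sub]; congr 1; abel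
    _ = (z - w) • resolvent a z - 1 := by rw [sub_mul, h, Algebra.smul_def]

variable [CompleteSpace A]

theorem ContinuousLinearMap.circleIntegral_comp_comm {E F : Type*} [NormedAddCommGroup E]
    [NormedSpace ℂ E] [NormedAddCommGroup F] [NormedSpace ℂ F] [CompleteSpace E] [CompleteSpace F]
    (L : E →L[ℂ] F) {f : ℂ → E} {c : ℂ} {R : ℝ} (hf : CircleIntegrable f c R) :
    (∮ z in C(c, R), L (f z)) = L (∮ z in C(c, R), f z) := by
  simp only [circleIntegral, ← map_smul]
  exact L.intervalIntegral_comp_comm hf.out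

theorem circleIntegral.integral_mul_left {f : ℂ → A} {c : ℂ} {R : ℝ}
    (hf : CircleIntegrable f c R) (b : A) :
    (∮ z in C(c, R), b * f z) = b * ∮ z in C(c, R), f z :=
  (ContinuousLinearMap.mul ℂ A b).circleIntegral_comp_comm hf

theorem circleIntegral.integral_mul_right {f : ℂ → A} {c : ℂ} {R : ℝ}
    (hf : CircleIntegrable f c R) (b : A) :
    (∮ z in C(c, R), f z * b) = (∮ z in C(c, R), f z) * b :=
  ((ContinuousLinearMap.mul ℂ A).flip b).circleIntegral_comp_comm hf

theorem Commute.circleIntegral_right {f : ℂ → A} {c : ℂ} {R : ℝ} (hR : 0 ≤ R)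
    (hf : CircleIntegrable f c R) {b : A} (h : ∀ z ∈ sphere c R, Commute b (f z)) :
    Commute b (∮ z in C(c, R), f z) := by
  rw [commute_iff_eq, ← circleIntegral.integral_mul_left hf, ← circleIntegral.integral_mul_right hf]
  exact circleIntegral.integral_congr hR fun z hz => (h z hz).eq

theorem circleIntegral_sub_inv_of_lt_norm {w : ℂ} {r : ℝ} (hr : 0 ≤ r) (hw : r < ‖w‖) :
    (∮ z in C(0, r), (z - w)⁻¹) = 0 := by
  have hne : ∀ z ∈ closedBall (0 : ℂ) r, z - w ≠ 0 := fun z hz h => by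
    rw [mem_closedBall_zero_iff, sub_eq_zero.1 h] at hz
    exact hz.not_gt hw
  refine circleIntegral_eq_zero_of_differentiable_on_off_countable hr Set.countable_empty
    ((continuousOn_id.sub continuousOn_const).inv₀ hne) fun z hz => ?_
  exact (differentiableAt_id.sub_const w).inv (hne z (ball_subset_closedBall hz.1))

theorem continuousOn_resolvent (a : A) : ContinuousOn (resolvent a) (resolventSet ℂ a) :=
  fun _ hz => (spectrum.hasDerivAt_resolvent_const_left hz).continuousAt.continuousWithinAt

/-- The Cauchy integral of the resolvent of `a` over the circle of radius `r` around `0`. -/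
noncomputable def resolventCauchyIntegral (a : A) (r : ℝ) (w : ℂ) : A :=
  (2 * π * I : ℂ)⁻¹ • ∮ z in C(0, r), (z - w)⁻¹ • resolvent a z

/-- The Riesz projection of `a` belonging to the part of its spectrum in the disc of radius `r`. -/
noncomputable def rieszProjection (a : A) (r : ℝ) : A :=
  (2 * π * I : ℂ)⁻¹ • ∮ z in C(0, r), resolvent a z

variable {a : A} {r : ℝ}

theorem circleIntegrable_resolvent (hr : 0 ≤ r) (h : sphere 0 r ⊆ resolventSet ℂ a) :
    CircleIntegrable (resolvent a) 0 r :=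
  ((continuousOn_resolvent a).mono h).circleIntegrable hr

theorem circleIntegrable_sub_inv_smul_resolvent (hr : 0 ≤ r) (h : sphere 0 r ⊆ resolventSet ℂ a)
    {w : ℂ} (hw : ‖w‖ ≠ r) : CircleIntegrable (fun z => (z - w)⁻¹ • resolvent a z) 0 r := by
  refine ContinuousOn.circleIntegrable hr
    (((continuousOn_id.sub continuousOn_const).inv₀ fun z hz hzw => hw ?_).smul
      ((continuousOn_resolvent a).mono h))
  rw [← sub_eq_zero.1 (show z - w = 0 from hzw)]
  simpa using hz

theorem Commute.rieszProjection_right (hr : 0 ≤ r) (h : sphere 0 r ⊆ resolventSet ℂ a) {b : A}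
    (hb : Commute b a) : Commute b (rieszProjection a r) :=
  (Commute.circleIntegral_right hr (circleIntegrable_resolvent hr h)
    fun z _ => hb.resolvent_right z).smul_right _

theorem Commute.resolventCauchyIntegral_right (hr : 0 ≤ r) (h : sphere 0 r ⊆ resolventSet ℂ a)
    {w : ℂ} (hw : ‖w‖ ≠ r) {b : A} (hb : Commute b a) :
    Commute b (resolventCauchyIntegral a r w) :=
  (Commute.circleIntegral_right hr (circleIntegrable_sub_inv_smul_resolvent hr h hw)
    fun z _ => (hb.resolvent_right z).smul_right _).smul_right _

/-- Comes from integrating `resolventSet.sub_mul_resolvent` divided by `z - w`. The scalar is the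
winding number of the circle about `w`: `1` inside, `0` outside. So the Cauchy integral inverts `a -
w` up to sign on the complementary part inside, and on the Riesz part outside. -/
theorem sub_mul_resolventCauchyIntegral (hr : 0 ≤ r) (h : sphere 0 r ⊆ resolventSet ℂ a)
    {w : ℂ} (hw : ‖w‖ ≠ r) :
    (a - algebraMap ℂ A w) * resolventCauchyIntegral a r w =
      rieszProjection a r - ((2 * π * I : ℂ)⁻¹ * ∮ z in C(0, r), (z - w)⁻¹) • 1 := by
  have hne : ∀ z ∈ sphere (0 : ℂ) r, z - w ≠ 0 := fun z hz hzw => hw <| by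
    rw [← sub_eq_zero.1 hzw]
    simpa using hz
  have hint : CircleIntegrable (fun z => (z - w)⁻¹ • (1 : A)) 0 r :=
    ContinuousOn.circleIntegrable hr
      (((continuousOn_id.sub continuousOn_const).inv₀ hne).smul continuousOn_const)
  rw [resolventCauchyIntegral, mul_smul_comm,
    ← circleIntegral.integral_mul_left (circleIntegrable_sub_inv_smul_resolvent hr h hw),
    rieszProjection, mul_smul, ← circleIntegral.integral_smul_const, ← smul_sub,
    ← circleIntegral.integral_sub (circleIntegrable_resolvent hr h) hint]
  congr 1
  refine circleIntegral.integral_congr hr fun z hz => ?_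
  rw [mul_smul_comm, resolventSet.sub_mul_resolvent (h hz), smul_sub,
    inv_smul_smul₀ (hne z hz)]

theorem sub_mul_resolventCauchyIntegral_of_norm_lt (h : sphere 0 r ⊆ resolventSet ℂ a)
    {w : ℂ} (hw : ‖w‖ < r) :
    (a - algebraMap ℂ A w) * resolventCauchyIntegral a r w = rieszProjection a r - 1 := by
  rw [sub_mul_resolventCauchyIntegral ((norm_nonneg w).trans hw.le) h hw.ne,
    circleIntegral.integral_sub_inv_of_mem_ball (by simpa using hw),
    inv_mul_cancel₀ two_pi_I_ne_zero, one_smul]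

theorem sub_mul_resolventCauchyIntegral_of_lt_norm (hr : 0 ≤ r)
    (h : sphere 0 r ⊆ resolventSet ℂ a) {w : ℂ} (hw : r < ‖w‖) :
    (a - algebraMap ℂ A w) * resolventCauchyIntegral a r w = rieszProjection a r := by
  rw [sub_mul_resolventCauchyIntegral hr h hw.ne', circleIntegral_sub_inv_of_lt_norm hr hw,
    mul_zero, zero_smul, sub_zero]

/-- A Cauchy integral is analytic in the disc whatever its density; the resolvent itself may be
singular there. -/
theorem differentiableOn_resolventCauchyIntegral (hr : 0 < r)
    (h : sphere 0 r ⊆ resolventSet ℂ a) :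
    DifferentiableOn ℂ (resolventCauchyIntegral a r) (ball 0 r) := by
  lift r to NNReal using hr.le
  have := hasFPowerSeriesOn_cauchy_integral (circleIntegrable_resolvent hr.le h) hr
  have := this.differentiableOn
  rwa [Metric.eball_coe] at this

theorem rieszProjection_eq_of_annulus_subset {s : ℝ} (hs : 0 < s) (hsr : s ≤ r)
    (h : closedBall 0 r \ ball 0 s ⊆ resolventSet ℂ a) :
    rieszProjection a r = rieszProjection a s := by
  rw [rieszProjection, rieszProjection]
  congr 1
  refine circleIntegral_eq_of_differentiable_on_annulus_off_countable hs hsr Set.countable_empty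
    ((continuousOn_resolvent a).mono h) fun z hz => ?_
  exact (spectrum.hasDerivAt_resolvent_const_left
    (h ⟨ball_subset_closedBall hz.1.1, fun h' => hz.1.2 (ball_subset_closedBall h')⟩)).differentiableAt

theorem exists_annulus_subset_resolventSet (hr : 0 < r) (h : sphere 0 r ⊆ resolventSet ℂ a) :
    ∃ s, 0 < s ∧ s < r ∧ closedBall 0 r \ ball 0 s ⊆ resolventSet ℂ a := by
  have hK : IsClosed ((fun z : ℂ => ‖z‖) '' spectrum ℂ a) :=
    ((spectrum.isCompact a).image continuous_norm).isClosed
  have hrK : r ∈ ((fun z : ℂ => ‖z‖) '' spectrum ℂ a)ᶜ := by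
    rintro ⟨z, hz, hzr⟩
    exact hz (h (by simpa using hzr))
  obtain ⟨δ, hδ, hball⟩ := Metric.isOpen_iff.1 hK.isOpen_compl r hrK
  -- `r / 2` keeps `s` positive; `r - δ / 2` keeps the annulus within distance `δ` of the circle.
  refine ⟨max (r / 2) (r - δ / 2), by positivity, by simp [hr, hδ], fun z hz => ?_⟩
  have h1 : ‖z‖ ≤ r := by simpa using hz.1
  have h2 : r - δ / 2 ≤ ‖z‖ := (le_max_right _ _).trans (by simpa using hz.2)
  by_contra hz'
  refine hball (a := ‖z‖) ?_ ⟨z, hz', rfl⟩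
  rw [Real.ball_eq_Ioo]
  exact ⟨by linarith, by linarith⟩

/-- Shrinking the circle to radius `s` does not change the projection. On the smaller circle,
resolvent times projection is the resolvent minus a function holomorphic inside, whose integral
vanishes. -/
theorem isIdempotentElem_rieszProjection (hr : 0 < r) (h : sphere 0 r ⊆ resolventSet ℂ a) :
    IsIdempotentElem (rieszProjection a r) := by
  obtain ⟨s, hs, hsr, hann⟩ := exists_annulus_subset_resolventSet hr h
  have hsphere : sphere 0 s ⊆ resolventSet ℂ a := fun z hz => hann (by
    rw [mem_sphere_zero_iff_norm] at hz
    simp [hz, hsr.le])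
  have hsub : closedBall (0 : ℂ) s ⊆ ball 0 r := closedBall_subset_ball hsr
  have hdiff := differentiableOn_resolventCauchyIntegral hr h
  have hzero : (∮ w in C(0, s), resolventCauchyIntegral a r w) = 0 :=
    circleIntegral_eq_zero_of_differentiable_on_off_countable hs.le Set.countable_empty
      (hdiff.continuousOn.mono hsub) fun w hw =>
        hdiff.differentiableAt (isOpen_ball.mem_nhds (hsub (ball_subset_closedBall hw.1)))
  have hint : CircleIntegrable (resolventCauchyIntegral a r) 0 s :=
    (hdiff.continuousOn.mono (sphere_subset_closedBall.trans hsub)).circleIntegrable hs.le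
  have key : ∀ w ∈ sphere (0 : ℂ) s, resolvent a w * rieszProjection a r =
      resolvent a w - resolventCauchyIntegral a r w := by
    intro w hw
    have hw' : ‖w‖ < r := by
      rw [mem_sphere_zero_iff_norm] at hw
      exact hw ▸ hsr
    have h1 := sub_mul_resolventCauchyIntegral_of_norm_lt h hw'
    have h2 : resolvent a w * (algebraMap ℂ A w - a) = 1 :=
      Ring.inverse_mul_cancel _ (hsphere hw)
    have h3 : rieszProjection a r = 1 - (algebraMap ℂ A w - a) * resolventCauchyIntegral a r w := by
      rw [← neg_sub a, neg_mul, h1]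
      abel
    rw [h3, mul_sub, ← mul_assoc, h2, mul_one, one_mul]
  have hI := circleIntegrable_resolvent hs.le hsphere
  have heq : rieszProjection a s * rieszProjection a r = rieszProjection a s := by
    rw [rieszProjection, smul_mul_assoc, ← circleIntegral.integral_mul_right hI,
      circleIntegral.integral_congr hs.le key, circleIntegral.integral_sub hI hint, hzero, sub_zero]
  rwa [← rieszProjection_eq_of_annulus_subset hs hsr.le hann] at heq

end RieszProjection

/-! ### Fredholm, Browder and Drazin regularity -/

section Operators

variable {X : Type u} [NormedAddCommGroup X] [NormedSpace ℂ X]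

theorem hasFiniteAscent_iff {S : X →L[ℂ] X} :
    HasFiniteAscent S ↔ ∃ p : ℕ, ∀ x, (S ^ (p + 1)) x = 0 → (S ^ p) x = 0 := by
  refine exists_congr fun p => ⟨fun h x hx => ?_, fun h => le_antisymm (fun x hx => ?_) h⟩
  · have : x ∈ (S ^ p).ker := h ▸ hx
    exact this
  · have hx' : (S ^ p) x = 0 := hx
    change (S ^ (p + 1)) x = 0
    rw [pow_succ', mul_apply_eq_comp, hx', map_zero]

theorem hasFiniteDescent_iff {S : X →L[ℂ] X} :
    HasFiniteDescent S ↔ ∃ q : ℕ, ∀ x, ∃ y, (S ^ (q + 1)) y = (S ^ q) x := by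
  refine exists_congr fun q => ⟨fun h x => ?_, fun h => le_antisymm ?_ ?_⟩
  · have : (S ^ q) x ∈ (S ^ (q + 1)).range := h ▸ ⟨x, rfl⟩
    exact this
  · rintro _ ⟨x, rfl⟩
    exact h x
  · rintro _ ⟨x, rfl⟩
    exact ⟨S x, by simp [pow_succ]⟩

/-- Closedness of the range is automatic: `S` is injective on a closed complement of its kernel,
with the same range, and that range has a finite-dimensional, hence closed, complement. -/
theorem ContinuousLinearMap.isFredholm_of_finiteDimensional [CompleteSpace X] {S : X →L[ℂ] X}
    (hker : FiniteDimensional ℂ S.ker) (hrange : S.range.CoFG) : S.IsFredholm := by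
  have hker' : S.ker.ClosedComplemented := Submodule.ClosedComplemented.of_finiteDimensional S.ker
  obtain ⟨E, hEc, hE⟩ := hker'.exists_isClosed_isCompl
  obtain ⟨G, hG⟩ := Submodule.exists_isCompl S.range
  have : FiniteDimensional ℂ G := .of_fg (hrange.fg_of_isCompl hG)
  have := hEc.completeSpace_coe
  have hGc : IsClosed (G : Set X) := G.closed_of_finiteDimensional
  have hinj : (S.domRestrict E).ker = ⊥ := by
    rw [LinearMap.ker_eq_bot']
    intro x hx
    exact Subtype.ext (Submodule.disjoint_def.1 hE.disjoint _ hx x.2)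
  have hreq : (S.domRestrict E).range = S.range := by
    refine le_antisymm ?_ ?_
    · rintro _ ⟨x, rfl⟩
      exact ⟨x, rfl⟩
    · rintro _ ⟨x, rfl⟩
      obtain ⟨k, hk, e, he, rfl⟩ := Submodule.mem_sup.1
        (hE.sup_eq_top ▸ Submodule.mem_top : x ∈ S.ker ⊔ E)
      have hk' : S k = 0 := hk
      exact ⟨⟨e, he⟩, by simp [hk']⟩
  have hclosed : IsClosed (S.range : Set X) := by
    rw [← hreq]
    exact (S.domRestrict E).closed_complemented_range_of_isCompl_of_ker_eq_bot G
      (hreq ▸ hG) hGc hinj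
  have := hclosed.completeSpace_coe
  have hEfg : E.CoFG := by
    rw [Submodule.CoFG]
    exact Module.Finite.equiv (Submodule.quotientEquivOfIsCompl E S.ker hE.symm).symm
  have hmaps : Set.MapsTo S E S.range := fun x _ => ⟨x, rfl⟩
  have hbij : Function.Bijective (S.restrict hmaps) := by
    constructor
    · intro x y hxy
      exact LinearMap.ker_eq_bot.1 hinj (congrArg Subtype.val hxy)
    · rintro ⟨y, hy⟩
      obtain ⟨x, hx⟩ := hreq ▸ hy
      exact ⟨x, Subtype.ext hx⟩
  refine IsFredholm.of_isInvertible_restrict hEc hclosed hmaps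
    ⟨ContinuousLinearEquiv.ofBijective (S.restrict hmaps) (LinearMap.ker_eq_bot.2 hbij.1)
      (LinearMap.range_eq_top.2 hbij.2), ?_⟩
  ext x
  rfl

/-- `S` is invertible, Browder or Drazin invertible, according to `k`. -/
def IsRegularOperator (k : SpectrumKind) (S : X →L[ℂ] X) : Prop :=
  match k with
  | .usual => Function.Bijective S
  | .browder => IsBrowder S
  | .drazin => IsDrazinInvertible S

theorem mem_sigmaStar_iff [CompleteSpace X] {k : SpectrumKind} {T : X →L[ℂ] X} {z : ℂ} :
    z ∈ sigmaStar k T ↔ ¬ IsRegularOperator k (T - z • ContinuousLinearMap.id ℂ X) := by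
  cases k with
  | usual =>
    change z ∈ spectrum ℂ T ↔ _
    rw [spectrum.mem_iff, ← IsUnit.neg_iff, neg_sub, ContinuousLinearMap.isUnit_iff_bijective]
    rfl
  | browder => rfl
  | drazin => rfl

theorem mem_spectrum_iff_not_bijective [CompleteSpace X] {T : X →L[ℂ] X} {z : ℂ} :
    z ∈ spectrum ℂ T ↔ ¬ Function.Bijective (T - z • ContinuousLinearMap.id ℂ X) :=
  mem_sigmaStar_iff (k := .usual)

theorem isDrazinInvertible_of_bijective {S : X →L[ℂ] X} (hS : Function.Bijective S) :
    IsDrazinInvertible S := by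
  refine ⟨hasFiniteAscent_iff.2 ⟨0, fun x hx => ?_⟩, hasFiniteDescent_iff.2 ⟨0, fun x => ?_⟩⟩
  · simpa using (map_eq_zero_iff S hS.1).1 (by simpa using hx)
  · simpa using hS.2 x

theorem isRegularOperator_of_bijective [CompleteSpace X] (k : SpectrumKind) {S : X →L[ℂ] X}
    (hS : Function.Bijective S) : IsRegularOperator k S := by
  cases k with
  | usual => exact hS
  | browder =>
    refine ⟨ContinuousLinearMap.isFredholm_of_finiteDimensional ?_ ?_,
      isDrazinInvertible_of_bijective hS⟩
    · rw [LinearMap.ker_eq_bot.2 hS.1]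
      infer_instance
    · rw [LinearMap.range_eq_top.2 hS.2]
      exact Submodule.CoFG.top
  | drazin => exact isDrazinInvertible_of_bijective hS

theorem IsRegularOperator.isDrazinInvertible {k : SpectrumKind} {S : X →L[ℂ] X}
    (h : IsRegularOperator k S) : IsDrazinInvertible S := by
  cases k with
  | usual => exact isDrazinInvertible_of_bijective h
  | browder => exact h.2
  | drazin => exact h

/-! ### Bijectivity modulo an invariant subspace -/

theorem ContinuousLinearMap.coe_restrict_pow_apply {S : X →L[ℂ] X} {N : Submodule ℂ X}
    (hN : ∀ x ∈ N, S x ∈ N) (n : ℕ) (x : N) : (((S.restrict hN) ^ n) x : X) = (S ^ n) x := by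
  induction n generalizing x with
  | zero => rfl
  | succ n ih =>
    rw [pow_succ, pow_succ, mul_apply_eq_comp, mul_apply_eq_comp, ih]
    rfl

/-- The map induced by `S` on `X ⧸ N` is bijective. -/
structure IsBijectiveModulo (S : X →L[ℂ] X) (N : Submodule ℂ X) : Prop where
  mem_of_apply_mem : ∀ x, S x ∈ N → x ∈ N
  exists_apply_sub_mem : ∀ y, ∃ x, S x - y ∈ N

theorem isBijectiveModulo_of_isCompl {T : X →L[ℂ] X} {M N : Submodule ℂ X} (hMN : IsCompl M N)
    (hM : ∀ x ∈ M, T x ∈ M) (hN : ∀ x ∈ N, T x ∈ N) (h : Function.Bijective (T.restrict hM)) :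
    IsBijectiveModulo T N := by
  have hdec : ∀ x : X, ∃ m : M, ∃ n ∈ N, x = m + n := fun x => by
    obtain ⟨m, hm, n, hn, rfl⟩ := Submodule.mem_sup.1
      (hMN.sup_eq_top ▸ Submodule.mem_top : x ∈ M ⊔ N)
    exact ⟨⟨m, hm⟩, n, hn, rfl⟩
  constructor
  · intro x hx
    obtain ⟨m, n, hn, rfl⟩ := hdec x
    rw [map_add] at hx
    have hTm : T m = 0 := Submodule.disjoint_def.1 hMN.disjoint _ (hM m m.2)
      ((Submodule.add_mem_iff_left N (hN n hn)).1 hx)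
    have hm : m = 0 := h.1 (Subtype.ext (by simpa using hTm))
    simpa [hm] using hn
  · intro y
    obtain ⟨m, n, hn, rfl⟩ := hdec y
    obtain ⟨x, hx⟩ := h.2 m
    refine ⟨x, ?_⟩
    have hx' : T x = m := congrArg Subtype.val hx
    simpa [hx'] using hn

namespace IsBijectiveModulo

variable {S : X →L[ℂ] X} {N : Submodule ℂ X}

theorem mem_of_pow_apply_mem (h : IsBijectiveModulo S N) (n : ℕ) {x : X}
    (hx : (S ^ n) x ∈ N) : x ∈ N := by
  induction n with
  | zero => exact hx
  | succ n ih =>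
    rw [pow_succ', mul_apply_eq_comp] at hx
    exact ih (h.mem_of_apply_mem _ hx)

theorem exists_eq_apply_add (h : IsBijectiveModulo S N) (y : X) :
    ∃ x, ∃ n : N, y = S x + n := by
  obtain ⟨x, hx⟩ := h.exists_apply_sub_mem y
  exact ⟨x, ⟨_, N.neg_mem hx⟩, by simp⟩

theorem bijective (h : IsBijectiveModulo S N) {hN : ∀ x ∈ N, S x ∈ N}
    (hS : Function.Bijective (S.restrict hN)) : Function.Bijective S := by
  constructor
  · refine (injective_iff_map_eq_zero S).2 fun x hx => ?_
    have hxN : x ∈ N := h.mem_of_apply_mem x (hx ▸ N.zero_mem)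
    have : (⟨x, hxN⟩ : N) = 0 := hS.1 (Subtype.ext (by simpa using hx))
    exact congrArg Subtype.val this
  · intro y
    obtain ⟨x, n, rfl⟩ := h.exists_eq_apply_add y
    obtain ⟨m, hm⟩ := hS.2 n
    have hm' : S m = n := congrArg Subtype.val hm
    exact ⟨x + m, by simp [hm']⟩

theorem isDrazinInvertible (h : IsBijectiveModulo S N) {hN : ∀ x ∈ N, S x ∈ N}
    (hS : IsDrazinInvertible (S.restrict hN)) : IsDrazinInvertible S := by
  obtain ⟨p, hp⟩ := hasFiniteAscent_iff.1 hS.1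
  obtain ⟨q, hq⟩ := hasFiniteDescent_iff.1 hS.2
  refine ⟨hasFiniteAscent_iff.2 ⟨p, fun x hx => ?_⟩, hasFiniteDescent_iff.2 ⟨q, fun x => ?_⟩⟩
  · have hxN : x ∈ N := h.mem_of_pow_apply_mem (p + 1) (hx ▸ N.zero_mem)
    have := hp ⟨x, hxN⟩ (Subtype.ext (by
      rw [ContinuousLinearMap.coe_restrict_pow_apply]
      exact hx))
    rw [← ContinuousLinearMap.coe_restrict_pow_apply hN p ⟨x, hxN⟩, this]
    rfl
  -- With `x = S y + n` and `S^q n = S^(q+1) m`, the preimage is `y + m`.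
  · obtain ⟨y, n, rfl⟩ := h.exists_eq_apply_add x
    obtain ⟨m, hm⟩ := hq n
    have hm' := congrArg Subtype.val hm
    rw [ContinuousLinearMap.coe_restrict_pow_apply,
      ContinuousLinearMap.coe_restrict_pow_apply] at hm'
    refine ⟨y + m, ?_⟩
    rw [map_add, map_add, hm', pow_succ, mul_apply_eq_comp]

/-- The kernel of `S` lies in `N`, and `N` surjects onto the cokernel of `S`. -/
theorem isFredholm [CompleteSpace X] (h : IsBijectiveModulo S N) {hN : ∀ x ∈ N, S x ∈ N}
    (hS : (S.restrict hN).IsFredholm) : S.IsFredholm := by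
  refine ContinuousLinearMap.isFredholm_of_finiteDimensional ?_ ?_
  · have := hS.finite_ker
    have hle : S.ker ≤ (S.restrict hN).ker.map N.subtype := fun x hx =>
      ⟨⟨x, h.mem_of_apply_mem x ((show S x = 0 from hx) ▸ N.zero_mem)⟩, Subtype.ext hx, rfl⟩
    exact Submodule.finiteDimensional_of_le hle
  · have : Module.Finite ℂ (N ⧸ (S.restrict hN).range) := hS.finite_coker
    have hle : (S.restrict hN).range ≤ S.range.comap N.subtype := by
      rintro _ ⟨x, rfl⟩
      exact ⟨x, rfl⟩
    refine Module.Finite.of_surjective (Submodule.mapQ _ S.range N.subtype hle) fun y => ?_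
    obtain ⟨y, rfl⟩ := Submodule.mkQ_surjective _ y
    obtain ⟨x, n, rfl⟩ := h.exists_eq_apply_add y
    refine ⟨Submodule.mkQ _ n, ?_⟩
    rw [Submodule.mkQ_apply, Submodule.mapQ_apply, Submodule.mkQ_apply, Submodule.Quotient.eq]
    exact ⟨-x, by simp⟩

theorem isRegularOperator [CompleteSpace X] (h : IsBijectiveModulo S N) {hN : ∀ x ∈ N, S x ∈ N}
    {k : SpectrumKind} (hS : IsRegularOperator k (S.restrict hN)) : IsRegularOperator k S := by
  cases k with
  | usual => exact h.bijective hS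
  | browder => exact ⟨h.isFredholm hS.1, h.isDrazinInvertible hS.2⟩
  | drazin => exact h.isDrazinInvertible hS

/-- The map `Q` induced on the quotient is bijective, so `0` lies in its open resolvent set;
bijectivity of `Q - z` pulls back along `π`. -/
theorem exists_forall_norm_lt_of_semiconj {Y : Type*} [NormedAddCommGroup Y] [NormedSpace ℂ Y]
    [CompleteSpace Y] {Q : Y →L[ℂ] Y} {π : X →L[ℂ] Y} (h : IsBijectiveModulo S π.ker)
    (hπ : Function.Surjective π) (hQ : ∀ x, Q (π x) = π (S x)) :
    ∃ ε > 0, ∀ z : ℂ, ‖z‖ < ε →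
      IsBijectiveModulo (S - z • ContinuousLinearMap.id ℂ X) π.ker := by
  have hbij : Function.Bijective Q := by
    constructor
    · refine (injective_iff_map_eq_zero Q).2 fun y hy => ?_
      obtain ⟨x, rfl⟩ := hπ y
      rw [hQ] at hy
      exact h.mem_of_apply_mem x hy
    · intro y
      obtain ⟨y, rfl⟩ := hπ y
      obtain ⟨x, n, rfl⟩ := h.exists_eq_apply_add y
      have hn : π n = 0 := n.2
      exact ⟨π x, by rw [hQ, map_add, hn, add_zero]⟩
  have h0 : (0 : ℂ) ∈ (spectrum ℂ Q)ᶜ := by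
    rw [Set.mem_compl_iff, mem_spectrum_iff_not_bijective, not_not, zero_smul, sub_zero]
    exact hbij
  obtain ⟨ε, hε, hball⟩ := Metric.isOpen_iff.1 (spectrum.isClosed Q).isOpen_compl 0 h0
  refine ⟨ε, hε, fun z hz => ?_⟩
  have hz' : Function.Bijective (Q - z • ContinuousLinearMap.id ℂ Y) := by
    by_contra hcon
    exact hball (show z ∈ Metric.ball 0 ε by simpa using hz)
      (mem_spectrum_iff_not_bijective.2 hcon)
  have hQz : ∀ x, (Q - z • ContinuousLinearMap.id ℂ Y) (π x) =
      π ((S - z • ContinuousLinearMap.id ℂ X) x) := fun x => by simp [hQ]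
  constructor
  · intro x hx
    exact (injective_iff_map_eq_zero _).1 hz'.1 (π x) ((hQz x).trans hx)
  · intro y
    obtain ⟨x, hx⟩ := hz'.2 (π y)
    obtain ⟨x, rfl⟩ := hπ x
    refine ⟨x, ?_⟩
    change π _ = 0
    rw [map_sub, ← hQz, hx, sub_self]

/-- Bijectivity modulo a closed invariant subspace is stable under small scalar perturbations. -/
theorem exists_forall_norm_lt [CompleteSpace X] (h : IsBijectiveModulo S N)
    (hN : ∀ x ∈ N, S x ∈ N) (hclosed : IsClosed (N : Set X)) :
    ∃ ε > 0, ∀ z : ℂ, ‖z‖ < ε →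
      IsBijectiveModulo (S - z • ContinuousLinearMap.id ℂ X) N := by
  have : IsClosed (N : Set X) := hclosed
  have hker : N.mkQL.ker = N := N.ker_mkQ
  rw [← hker] at h ⊢
  exact h.exists_forall_norm_lt_of_semiconj (π := N.mkQL)
    (Q := N.liftQL (N.mkQL ∘L S) fun x hx => (Submodule.Quotient.mk_eq_zero N).2 (hN x hx))
    N.mkQ_surjective fun _ => rfl

end IsBijectiveModulo

/-! ### Punctured neighbourhoods and the topology of the spectra -/

theorem IsDrazinInvertible.exists_forall_bijective [CompleteSpace X] {S : X →L[ℂ] X}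
    (hS : IsDrazinInvertible S) : ∃ ε > 0, ∀ z : ℂ, z ≠ 0 → ‖z‖ < ε →
      Function.Bijective (S - z • ContinuousLinearMap.id ℂ X) := by
  obtain ⟨p, hp⟩ := hasFiniteAscent_iff.1 hS.1
  obtain ⟨q, hq⟩ := hasFiniteDescent_iff.1 hS.2
  have hker : ∀ x, (S ^ (q + p + 1)) x = 0 → (S ^ (q + p)) x = 0 := fun x hx => by
    rw [add_comm q p, pow_add, mul_apply_eq_comp]
    refine hp _ ?_
    rw [← mul_apply_eq_comp, ← pow_add]
    convert hx using 3
    omega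
  have hrange : ∀ x, ∃ y, (S ^ (q + p + 1)) y = (S ^ (q + p)) x := fun x => by
    obtain ⟨y, hy⟩ := hq x
    refine ⟨y, ?_⟩
    rw [show q + p + 1 = p + (q + 1) by omega, add_comm q p, pow_add S p (q + 1), pow_add S p q,
      mul_apply_eq_comp, mul_apply_eq_comp, hy]
  -- Kernels and ranges both stabilise at this exponent. So `S` is bijective modulo the closed
  -- kernel of `S ^ n` and nilpotent on it, and both parts of `S - z` are bijective for small
  -- nonzero `z`.
  generalize q + p = n at hker hrange
  have hN : ∀ x ∈ (S ^ n).ker, S x ∈ (S ^ n).ker := fun x hx => by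
    have hx' : (S ^ n) x = 0 := hx
    change (S ^ n * S) x = 0
    rw [← pow_succ, pow_succ', mul_apply_eq_comp, hx', map_zero]
  have hmod : IsBijectiveModulo S (S ^ n).ker := by
    constructor
    · intro x hx
      refine hker x ?_
      rw [pow_succ]
      exact hx
    · intro y
      obtain ⟨x, hx⟩ := hrange y
      refine ⟨x, ?_⟩
      change (S ^ n) (S x - y) = 0
      rw [map_sub, ← hx, pow_succ, mul_apply_eq_comp, sub_self]
  have hclosed : IsClosed ((S ^ n).ker : Set X) := (S ^ n).isClosed_ker
  obtain ⟨ε, hε, h⟩ := hmod.exists_forall_norm_lt hN hclosed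
  refine ⟨ε, hε, fun z hz0 hz => ?_⟩
  have := hclosed.completeSpace_coe
  have hNz : ∀ x ∈ (S ^ n).ker, (S - z • ContinuousLinearMap.id ℂ X) x ∈ (S ^ n).ker :=
    fun x hx => Submodule.sub_mem _ (hN x hx) (Submodule.smul_mem _ z hx)
  refine (h z hz).bijective (hN := hNz) ?_
  have hnil : IsNilpotent (S.restrict hN) := ⟨n, by
    ext x
    rw [ContinuousLinearMap.coe_restrict_pow_apply]
    exact x.2⟩
  have hunit : IsUnit (S.restrict hN - algebraMap ℂ _ z) :=
    by
    rw [sub_eq_add_neg, ← map_neg]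
    exact hnil.isUnit_add_right_of_commute ((neg_ne_zero.2 hz0).isUnit.map (algebraMap ℂ _))
      (Algebra.commute_algebraMap_right _ _)
  exact ContinuousLinearMap.isUnit_iff_bijective.1 hunit

theorem exists_forall_bijective_of_notMem_sigmaStar [CompleteSpace X] {k : SpectrumKind}
    {T : X →L[ℂ] X} {z : ℂ} (hz : z ∉ sigmaStar k T) :
    ∃ ε > 0, ∀ w : ℂ, w ≠ z → dist w z < ε → w ∉ spectrum ℂ T := by
  rw [mem_sigmaStar_iff, not_not] at hz
  obtain ⟨ε, hε, h⟩ := hz.isDrazinInvertible.exists_forall_bijective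
  refine ⟨ε, hε, fun w hw hwz => ?_⟩
  rw [mem_spectrum_iff_not_bijective, not_not]
  have := h (w - z) (sub_ne_zero.2 hw) (by rwa [← dist_eq_norm])
  rwa [sub_sub, ← add_smul, add_sub_cancel] at this

theorem sigmaStar_subset_spectrum [CompleteSpace X] (k : SpectrumKind) (T : X →L[ℂ] X) :
    sigmaStar k T ⊆ spectrum ℂ T := fun z hz => by
  rw [mem_sigmaStar_iff] at hz
  exact mem_spectrum_iff_not_bijective.2 (mt (isRegularOperator_of_bijective k) hz)

theorem isClosed_sigmaStar [CompleteSpace X] (k : SpectrumKind) (T : X →L[ℂ] X) :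
    IsClosed (sigmaStar k T) := by
  refine isOpen_compl_iff.1 (Metric.isOpen_iff.2 fun z hz => ?_)
  obtain ⟨ε, hε, h⟩ := exists_forall_bijective_of_notMem_sigmaStar hz
  refine ⟨ε, hε, fun w hw => ?_⟩
  by_cases hwz : w = z
  · exact hwz ▸ hz
  · exact fun hw' => h w hwz hw (sigmaStar_subset_spectrum k T hw')

theorem countable_spectrum_diff_sigmaStar [CompleteSpace X] (k : SpectrumKind) (T : X →L[ℂ] X) :
    (spectrum ℂ T \ sigmaStar k T).Countable := by
  refine Set.countable_of_forall_not_accPt fun z hz hacc => ?_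
  obtain ⟨ε, hε, h⟩ := exists_forall_bijective_of_notMem_sigmaStar hz.2
  obtain ⟨w, hw, hwz⟩ := accPt_iff_nhds.1 hacc _ (Metric.ball_mem_nhds z hε)
  exact h w hwz hw.1 hw.2.1

end Operators

/-! ### Splitting along a commuting idempotent -/

section Operators

variable {X : Type u} [NormedAddCommGroup X] [NormedSpace ℂ X]

section Idempotent

variable {S p : X →L[ℂ] X}

theorem IsIdempotentElem.apply_of_mem_range (hp : IsIdempotentElem p) {x : X}
    (hx : x ∈ p.range) : p x = x := by
  obtain ⟨y, rfl⟩ := hx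
  exact DFunLike.congr_fun hp.eq y

theorem IsIdempotentElem.isCompl_ker_range (hp : IsIdempotentElem p) :
    IsCompl p.ker p.range := by
  constructor
  · refine Submodule.disjoint_def.2 fun x hx hx' => ?_
    rw [← hp.apply_of_mem_range hx']
    exact hx
  · refine codisjoint_iff.2 (eq_top_iff.2 fun x _ => ?_)
    refine Submodule.mem_sup.2 ⟨x - p x, ?_, p x, ⟨x, rfl⟩, sub_add_cancel _ _⟩
    change p (x - p x) = 0
    rw [map_sub, hp.apply_of_mem_range (x := p x) ⟨x, rfl⟩, sub_self]

theorem IsIdempotentElem.isClosed_range_clm (hp : IsIdempotentElem p) :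
    IsClosed (p.range : Set X) := by
  have : (p.range : Set X) = {x | p x = x} := Set.ext fun x =>
    ⟨fun hx => hp.apply_of_mem_range hx, fun hx => ⟨x, hx⟩⟩
  rw [this]
  exact isClosed_eq p.continuous continuous_id

theorem Commute.apply_mem_ker (h : Commute S p) {x : X} (hx : x ∈ p.ker) : S x ∈ p.ker := by
  have hx' : p x = 0 := hx
  change (p * S) x = 0
  rw [← h.eq, mul_apply_eq_comp, hx', map_zero]

theorem Commute.apply_mem_range (h : Commute S p) {x : X} (hx : x ∈ p.range) :
    S x ∈ p.range := by
  obtain ⟨y, rfl⟩ := hx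
  exact ⟨S y, (DFunLike.congr_fun h.eq y).symm⟩

theorem IsDrazinInvertible.restrict_range (hS : IsDrazinInvertible S) (hp : IsIdempotentElem p)
    (hSp : Commute S p) (hN : ∀ x ∈ p.range, S x ∈ p.range) :
    IsDrazinInvertible (S.restrict hN) := by
  obtain ⟨m, hm⟩ := hasFiniteAscent_iff.1 hS.1
  obtain ⟨n, hn⟩ := hasFiniteDescent_iff.1 hS.2
  refine ⟨hasFiniteAscent_iff.2 ⟨m, fun x hx => Subtype.ext ?_⟩,
    hasFiniteDescent_iff.2 ⟨n, fun x => ?_⟩⟩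
  · rw [ContinuousLinearMap.coe_restrict_pow_apply]
    refine hm x ?_
    rw [← ContinuousLinearMap.coe_restrict_pow_apply hN, hx]
    rfl
  · obtain ⟨y, hy⟩ := hn x
    refine ⟨⟨p y, y, rfl⟩, Subtype.ext ?_⟩
    rw [ContinuousLinearMap.coe_restrict_pow_apply, ContinuousLinearMap.coe_restrict_pow_apply,
      ← mul_apply_eq_comp, (hSp.pow_left (n + 1)).eq, mul_apply_eq_comp, hy, ← mul_apply_eq_comp,
      ← (hSp.pow_left n).eq, mul_apply_eq_comp, hp.apply_of_mem_range x.2]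

/-- The kernel embeds in that of `S`; since `p` maps the range of `S` into that of the restriction,
it induces a surjection of cokernels. -/
theorem IsIdempotentElem.isFredholm_restrict_range [CompleteSpace X] (hp : IsIdempotentElem p)
    (hS : S.IsFredholm) (hSp : Commute S p) (hN : ∀ x ∈ p.range, S x ∈ p.range) :
    (S.restrict hN).IsFredholm := by
  have := hp.isClosed_range_clm.completeSpace_coe
  refine ContinuousLinearMap.isFredholm_of_finiteDimensional ?_ ?_
  · have := hS.finite_ker
    have hle : ∀ x ∈ (S.restrict hN).ker, p.range.subtype x ∈ S.ker := fun x hx =>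
      congrArg Subtype.val (show S.restrict hN x = 0 from hx)
    exact Module.Finite.of_injective (p.range.subtype.restrict hle) fun x y hxy => by
      have h : ((x : p.range) : X) = (y : p.range) := congrArg (Subtype.val : S.ker → X) hxy
      exact Subtype.ext (Subtype.ext h)
  · have : Module.Finite ℂ (X ⧸ S.range) := hS.finite_coker
    have hle : S.range ≤ (S.restrict hN).range.comap p.toLinearMap.rangeRestrict := by
      rintro _ ⟨x, rfl⟩
      exact ⟨⟨p x, x, rfl⟩, Subtype.ext (DFunLike.congr_fun hSp.eq x)⟩
    refine Module.Finite.of_surjective (Submodule.mapQ _ (S.restrict hN).range _ hle) fun y => ?_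
    obtain ⟨y, rfl⟩ := Submodule.mkQ_surjective _ y
    refine ⟨Submodule.mkQ _ y, ?_⟩
    rw [Submodule.mkQ_apply, Submodule.mapQ_apply]
    exact congrArg _ (Subtype.ext (hp.apply_of_mem_range y.2))

theorem IsRegularOperator.restrict_range [CompleteSpace X] {k : SpectrumKind}
    (hS : IsRegularOperator k S) (hp : IsIdempotentElem p) (hSp : Commute S p)
    (hN : ∀ x ∈ p.range, S x ∈ p.range) : IsRegularOperator k (S.restrict hN) := by
  cases k with
  | usual =>
    have hS' : Function.Bijective S := hS
    refine ⟨fun x y hxy => Subtype.ext (hS'.1 (congrArg Subtype.val hxy)), fun x => ?_⟩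
    obtain ⟨y, hy⟩ := hS'.2 x
    refine ⟨⟨p y, y, rfl⟩, Subtype.ext ?_⟩
    rw [ContinuousLinearMap.coe_restrict_apply, ← mul_apply_eq_comp, hSp.eq, mul_apply_eq_comp, hy,
      hp.apply_of_mem_range x.2]
  | browder =>
    exact ⟨hp.isFredholm_restrict_range hS.1 hSp hN, IsDrazinInvertible.restrict_range hS.2 hp hSp hN⟩
  | drazin => exact IsDrazinInvertible.restrict_range hS hp hSp hN

end Idempotent

theorem bijective_restrict_of_inverse_on {S R : X →L[ℂ] X} {N : Submodule ℂ X}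
    (hN : ∀ x ∈ N, S x ∈ N) (hR : ∀ x ∈ N, R x ∈ N) (hSR : Commute S R)
    (h : ∀ x ∈ N, S (R x) = x) : Function.Bijective (S.restrict hN) := by
  refine Function.bijective_iff_has_inverse.2 ⟨R.restrict hR, fun x => Subtype.ext ?_,
    fun x => Subtype.ext (h x x.2)⟩
  exact (DFunLike.congr_fun hSR.eq x.1).symm.trans (h x x.2)

theorem commute_sub_smul_id {T b : X →L[ℂ] X} (h : Commute T b) (z : ℂ) :
    Commute (T - z • ContinuousLinearMap.id ℂ X) b :=
  h.sub_left ((Commute.one_left b).smul_left z)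

open Metric in
theorem exists_riesz_decomposition [CompleteSpace X] (k : SpectrumKind) (T : X →L[ℂ] X) {r : ℝ}
    (hr : 0 < r) (h : ∀ z ∈ spectrum ℂ T, ‖z‖ ≠ r) :
    ∃ (M N : Submodule ℂ X) (hM : IsInvariantSubspace T M) (hN : IsInvariantSubspace T N),
      IsClosed (M : Set X) ∧ IsClosed (N : Set X) ∧ IsCompl M N ∧ IsUnit (T.restrict hM) ∧
        sigmaStar k (T.restrict hN) ⊆ sigmaStar k T ∩ closedBall 0 r := by
  have hsphere : sphere 0 r ⊆ resolventSet ℂ T := fun z hz => by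
    by_contra hz'
    exact h z hz' (by simpa using hz)
  set p := rieszProjection T r with hp_def
  have hp : IsIdempotentElem p := isIdempotentElem_rieszProjection hr hsphere
  have hcomm : ∀ {b : X →L[ℂ] X}, Commute b T → Commute b p :=
    fun hb => hb.rieszProjection_right hr.le hsphere
  have hTp : Commute T p := hcomm (Commute.refl T)
  have hRT : ∀ {w : ℂ}, ‖w‖ ≠ r → Commute T (resolventCauchyIntegral T r w) := fun hw =>
    Commute.resolventCauchyIntegral_right hr.le hsphere hw (Commute.refl T)
  have hM : IsInvariantSubspace T p.ker := fun x hx => hTp.apply_mem_ker hx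
  have hN : IsInvariantSubspace T p.range := fun x hx => hTp.apply_mem_range hx
  have := hp.isClosed_range_clm.completeSpace_coe
  have := p.isClosed_ker.completeSpace_coe
  refine ⟨p.ker, p.range, hM, hN, p.isClosed_ker, hp.isClosed_range_clm, hp.isCompl_ker_range,
    ?_, fun z hz => ?_⟩
  · have h0 : ‖(0 : ℂ)‖ < r := by simpa using hr
    have hinv := sub_mul_resolventCauchyIntegral_of_norm_lt hsphere h0
    rw [map_zero, sub_zero] at hinv
    have hR := hRT h0.ne
    -- At `w = 0` the product with the Cauchy integral is `p - 1`, which is `-1` on the kernel of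
    -- `p`; hence the sign.
    refine ContinuousLinearMap.isUnit_iff_bijective.2
      (bijective_restrict_of_inverse_on (R := -resolventCauchyIntegral T r 0) hM
        (fun x hx => (hcomm hR.symm.neg_left).apply_mem_ker hx) hR.neg_right fun x hx => ?_)
    have hx' : p x = 0 := hx
    have := DFunLike.congr_fun hinv x
    rw [mul_apply_eq_comp, sub_apply, ← hp_def, hx', zero_sub] at this
    rw [neg_apply, map_neg, this]
    exact neg_neg x
  · have hNz : ∀ x ∈ p.range, (T - z • ContinuousLinearMap.id ℂ X) x ∈ p.range := fun x hx =>
      (commute_sub_smul_id hTp z).apply_mem_range hx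
    have hz' := mem_sigmaStar_iff.1 hz
    refine ⟨mem_sigmaStar_iff.2 fun hreg =>
      hz' (hreg.restrict_range hp (commute_sub_smul_id hTp z) hNz), ?_⟩
    rw [mem_closedBall_zero_iff]
    -- Outside the disc the product with the Cauchy integral is `p`, the identity on its range.
    by_contra! hzr
    have hR := hRT hzr.ne'
    have hinv := sub_mul_resolventCauchyIntegral_of_lt_norm hr.le hsphere hzr
    refine hz' (isRegularOperator_of_bijective k
      (bijective_restrict_of_inverse_on (R := resolventCauchyIntegral T r z) hNz
        (fun x hx => (hcomm hR.symm).apply_mem_range hx) (commute_sub_smul_id hR z) fun x hx => ?_))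
    exact (DFunLike.congr_fun hinv x).trans (hp.apply_of_mem_range hx)

/-! ### From bijectivity modulo `N` to a closed decomposition -/

theorem hasGDecomposition_of_isBijectiveModulo [CompleteSpace X] {k : SpectrumKind}
    {T : X →L[ℂ] X} {γ : Ordinal.{v}} {N : Submodule ℂ X} (hN : IsInvariantSubspace T N)
    (hclosed : IsClosed (N : Set X)) (hmod : IsBijectiveModulo T N)
    (hacc : accIter (sigmaStar k (T.restrict hN)) γ ⊆ {0}) : HasGDecomposition k T γ := by
  have := hclosed.completeSpace_coe
  obtain ⟨ε, hε, hsmall⟩ := hmod.exists_forall_norm_lt hN hclosed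
  have hsub : sigmaStar k T ∩ Metric.closedBall 0 (ε / 2) ⊆ sigmaStar k (T.restrict hN) := by
    intro z hz
    have hzε : ‖z‖ < ε := by
      have := mem_closedBall_zero_iff.1 hz.2
      linarith
    have hNz : ∀ x ∈ N, (T - z • ContinuousLinearMap.id ℂ X) x ∈ N :=
      fun x hx => N.sub_mem (hN x hx) (N.smul_mem z hx)
    refine mem_sigmaStar_iff.2 fun hreg => mem_sigmaStar_iff.1 hz.1 ?_
    exact (hsmall z hzε).isRegularOperator (hN := hNz) hreg
  have hacc' := (accIter_mono hsub γ).trans hacc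
  have hcount : (spectrum ℂ T ∩ Metric.closedBall 0 (ε / 2)).Countable := by
    refine ((((isClosed_sigmaStar k T).inter
      Metric.isClosed_closedBall).countable_of_accIter_subset_singleton hacc').union
      (countable_spectrum_diff_sigmaStar k T)).mono fun z hz => ?_
    by_cases hzk : z ∈ sigmaStar k T
    · exact Or.inl ⟨hzk, hz.2⟩
    · exact Or.inr ⟨hz.1, hzk⟩
  -- The circle must avoid all of `σ(T)`, not only `σ_*(T)`, for the resolvent to exist on it.
  obtain ⟨r, hr, hrε, hdisj⟩ := exists_radius_disjoint_sphere (half_pos hε) hcount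
  obtain ⟨M, N', hM, hN', hMc, hNc, hcompl, hunit, hσ⟩ := exists_riesz_decomposition k T hr hdisj
  refine ⟨M, N', hM, hN', hMc, hNc, hcompl, hunit, (accIter_mono (hσ.trans ?_) γ).trans hacc'⟩
  exact Set.inter_subset_inter_right _ (Metric.closedBall_subset_closedBall hrε.le)

theorem isGInvertible_add_one_iff {k : SpectrumKind} {T : X →L[ℂ] X} {γ : Ordinal.{v}} :
    IsGInvertible k T (γ + 1) ↔ HasGDecomposition k T γ := by
  refine ⟨?_, fun h => Or.inr (Or.inl ⟨γ, rfl, h⟩)⟩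
  rintro (⟨h, -⟩ | ⟨γ', h, hdec⟩ | ⟨h, -⟩)
  · exact absurd h (Order.succ_ne_bot γ)
  · rwa [Order.succ_injective (by simpa using h : Order.succ γ = Order.succ γ')]
  · exact absurd h (Order.not_isSuccLimit_succ γ)

end Operators

theorem mainTheorem5 {X : Type u} [NormedAddCommGroup X] [NormedSpace ℂ X] [CompleteSpace X]
    (k : SpectrumKind) (T : X →L[ℂ] X) (α γ : Ordinal.{v}) (hα : α = γ + 1) :
    IsGInvertible k T α ↔
      ∃ (M N : Submodule ℂ X) (hM : IsInvariantSubspace T M) (hN : IsInvariantSubspace T N),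
        IsClosed (N : Set X) ∧ IsCompl M N ∧ Function.Bijective (T.restrict hM) ∧
          accIter (sigmaStar k (T.restrict hN)) γ ⊆ {0} := by
  rw [hα, isGInvertible_add_one_iff]
  constructor
  · rintro ⟨M, N, hM, hN, hMc, hNc, hMN, hunit, hacc⟩
    have := hMc.completeSpace_coe
    exact ⟨M, N, hM, hN, hNc, hMN, ContinuousLinearMap.isUnit_iff_bijective.1 hunit, hacc⟩
  · rintro ⟨M, N, hM, hN, hNc, hMN, hbij, hacc⟩
    exact hasGDecomposition_of_isBijectiveModulo hN hNc
      (isBijectiveModulo_of_isCompl hMN hM hN hbij) hacc
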